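/- Let $l\ge 3$, $1\le s\le l$, let $\mathbb G=\mathrm{Grass}(s,l+1)$ be the Grassmannian of $s$-planes in $\mathbb C^{l+1}$, of dimension $N=s(l+1-s)$, with Plücker line bundle $\mathcal O_{\mathbb G}(1)$. Let $a>l$, let $\sigma\in H^0(\mathbb G,\mathcal O_{\mathbb G}(a))$ have smooth divisor $X=(\sigma=0)$, and let $R\in H^0(\mathbb G,\mathcal O_{\mathbb G}(a))$. Let $\mathcal X\subset\mathbb G\times\operatorname{Spec}\mathbb C[t]/(t^2)$ be the infinitesimal deformation of $X$ given by $\sigma+tR=0$, with associated exact sequence $$0\to\mathcal O_X(2)\to\Omega^1_{\mathcal X|X}(2)\to\Omega^1_X(2)\to0 ,\qquad(1)$$ and consider the twisted conormal sequence $$0\to\mathcal O_X(2-a)\to\Omega^1_{\mathbb G|X}(2)\to\Omega^1_X(2)\to0 .\qquad(2)$$ Let $\phi\colon\Omega^1_{\mathbb G|X}(2)\to\Omega^1_{\mathcal X|X}(2)$ be the pull-back of forms along the projection $\mathcal X\to\mathbb G$. 1. The map $\phi$ is compatible with the restriction maps of (1) and (2) to $\Omega^1_X(2)$, i.e. it splits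 the pull-back of (1) to $\Omega^1_{\mathbb G|X}(2)$. 2. Taking $d\sigma$ and $-dt$ as generators of the line subbundles (up to twist) in (2) and (1), one has isomorphisms on global sections $$H^0(X,\det(\Omega^1_{\mathbb G|X}(2)))\cong H^0(X,\Omega^{N-1}_X(2N-a)),\quad d\sigma\wedge\tilde\beta\leftrightarrow\beta,$$ $$H^0(X,\det(\Omega^1_{\mathcal X|X}(2)))\cong H^0(X,\Omega^{N-1}_X(2N)),\quad -dt\wedge\tilde\beta\leftrightarrow\beta,$$ where $\tilde\beta$ denotes a local lift of $\beta$. Under them the map $$\phi^n\colon H^0(X,\Omega^{N-1}_X(2N-a))\to H^0(X,\Omega^{N-1}_X(2N))$$ induced by $\bigwedge^N\phi$ is the multiplication by $R_{|X}\in H^0(X,\mathcal O_X(a))$. (With the generator $dt$ in place of $-dt$ the result is multiplied by $-1$.) 3. Let $\eta_1,\dots,\eta_N\in H^0(X,\Omega^1_X(2))$ have liftings $\tilde s_1,\dots,\tilde s_N\in H^0(X,\Omega^1_{\mathbb G|X}(2))$, and put $s_i=\phi(\tilde s_i)$. Then the $s_i\in H^0(X,\Omega^1_{\mathcal X|X}(2))$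 are liftings of the $\eta_i$, and the generalized adjoint forms $\widetilde\Omega\in H^0(X,\Omega^{N-1}_X(2N-a))$ and $\Omega\in H^0(X,\Omega^{N-1}_X(2N))$, corresponding to $\tilde s_1\wedge\dots\wedge\tilde s_N$ and $s_1\wedge\dots\wedge s_N$ under the isomorphisms of part 2, satisfy $\Omega=\widetilde\Omega\cdot R_{|X}$. -/

import Mathlib

/-!
Twisted differential forms on a smooth hypersurface `X` of the complex Grassmannian
`𝔾 = Grass(s, l+1)` and on its first order embedded deformation `σ + t R = 0`.

`𝔾` is the quotient of the open set of `s`-frames in `ℂ^(l+1)` by `GL_s`, and `𝒪(k)` is the line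
bundle associated with `det ^ k` (so that the Plücker coordinates are sections of `𝒪(1)`).
Accordingly a section over `X` of a bundle twisted by `𝒪(k)` is a holomorphic family, indexed by the
frames of the points of `X`, of elements of the fibres, with weight `det ^ k` under `GL_s`.
-/

namespace GrassAdjoint

/-- The Grassmannian of `s`-dimensional subspaces of `ℂ^(l+1)`. -/
def Grass (s l : ℕ) : Type :=
  {V : Submodule ℂ (Fin (l + 1) → ℂ) // Module.finrank ℂ V = s}

/-- `s`-tuples of vectors of `ℂ^(l+1)`; the frames are the linearly independent ones. -/
abbrev Tup (s l : ℕ) : Type := Fin s → Fin (l + 1) → ℂ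

/-- The point of the Grassmannian spanned by a frame. -/
noncomputable def point {s l : ℕ} (A : Tup s l) (hA : LinearIndependent ℂ A) : Grass s l :=
  ⟨Submodule.span ℂ (Set.range A), by simpa using finrank_span_eq_card hA⟩

/-- The action of `s × s` matrices on tuples: `(g A)ᵢ = ∑ⱼ gᵢⱼ Aⱼ`. -/
def act {s l : ℕ} (g : Matrix (Fin s) (Fin s) ℂ) : Tup s l →ₗ[ℂ] Tup s l where
  toFun A := fun i => ∑ j, g i j • A j
  map_add' A B := by
    funext i
    simp [Finset.sum_add_distrib]
  map_smul' c A := by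
    funext i
    simp [Finset.smul_sum, smul_smul, mul_comm]

/-- The action on the tangent space `Tup × ℂ` of (tuples) `×` (the `t`-line): trivial on the second
factor. -/
def act₂ {s l : ℕ} (g : Matrix (Fin s) (Fin s) ℂ) : (Tup s l × ℂ) →ₗ[ℂ] (Tup s l × ℂ) :=
  (act g).prodMap LinearMap.id

/-- `H⁰(𝔾, 𝒪(k))`: holomorphic functions on the set of frames with `F (g A) = det g ^ k * F A`
(extended by `0` to the tuples which are not frames). -/
def Sec (s l : ℕ) (k : ℤ) : Submodule ℂ (Tup s l → ℂ) where
  carrier := {F | (∀ A, ¬ LinearIndependent ℂ A → F A = 0) ∧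
    AnalyticOnNhd ℂ F {A | LinearIndependent ℂ A} ∧
    ∀ (g : Matrix.GeneralLinearGroup (Fin s) ℂ) (A : Tup s l), LinearIndependent ℂ A →
      F (act (g : Matrix (Fin s) (Fin s) ℂ) A) =
        (g : Matrix (Fin s) (Fin s) ℂ).det ^ k * F A}
  zero_mem' := ⟨fun _ _ => rfl, analyticOnNhd_const, fun _ _ _ => by simp⟩
  add_mem' := by
    rintro F G ⟨h1, h2, h3⟩ ⟨h1', h2', h3'⟩
    refine ⟨fun A hA => by simp [h1 A hA, h1' A hA], h2.add h2', fun g A hA => ?_⟩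
    simp only [Pi.add_apply, h3 g A hA, h3' g A hA]
    ring
  smul_mem' := by
    rintro c F ⟨h1, h2, h3⟩
    refine ⟨fun A hA => by simp [h1 A hA], fun A hA => analyticAt_const.smul (h2 A hA), fun g A hA => ?_⟩
    simp only [Pi.smul_apply, smul_eq_mul, h3 g A hA]
    ring

/-- The hypersurface `X = (σ = 0)` of the Grassmannian. -/
def hypersurface {s l : ℕ} {k : ℤ} (σ : Sec s l k) : Set (Grass s l) :=
  {V | ∀ (A : Tup s l) (hA : LinearIndependent ℂ A), point A hA = V → σ.1 A = 0}

/-- Frames of the points of `X`. -/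
def FrameX {s l : ℕ} {k : ℤ} (σ : Sec s l k) : Type :=
  {A : Tup s l // ∃ hA : LinearIndependent ℂ A, point A hA ∈ hypersurface σ}

/-- The divisor `σ = 0` is smooth: `dσ` vanishes at no point of it. -/
def SmoothDivisor {s l : ℕ} {k : ℤ} (σ : Sec s l k) : Prop :=
  ∀ A : FrameX σ, fderiv ℂ σ.1 A.1 ≠ 0

section
variable {s l : ℕ} {a : ℤ}

/-- Tangent vectors of `𝔾 × {0}`, lifted to the frames. A tangent space of the Grassmannian at the
span of `A` is the quotient of this space by the vertical vectors `(act Y A, 0)`. -/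
def tanG (σ : Sec s l a) (_ : FrameX σ) : Submodule ℂ (Tup s l × ℂ) :=
  (LinearMap.snd ℂ (Tup s l) ℂ).ker

/-- Tangent vectors of `X × {0}`, lifted to the frames. -/
noncomputable def tanX (σ : Sec s l a) (A : FrameX σ) : Submodule ℂ (Tup s l × ℂ) :=
  ((fderiv ℂ σ.1 A.1).toLinearMap ∘ₗ LinearMap.fst ℂ (Tup s l) ℂ).ker ⊓
    (LinearMap.snd ℂ (Tup s l) ℂ).ker

/-- Tangent vectors, at the points of `X × {0}`, of the deformation `𝒳` of `X` given by
`σ + t R = 0`, `t² = 0`, lifted to the frames. Its dual modulo vertical vectors is the fibre of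
`Ω¹_𝒳|X`, the quotient of `Ω¹_(𝔾 × Spec ℂ[t])|X` by `d(σ + t R)`. -/
noncomputable def tanDef (σ R : Sec s l a) (A : FrameX σ) : Submodule ℂ (Tup s l × ℂ) :=
  (fderiv ℂ (fun q : Tup s l × ℂ => σ.1 q.1 + q.2 * R.1 q.1) (A.1, 0)).toLinearMap.ker

/-- For a family `T` of tangent spaces as above, containing the vertical vectors: the space
`H⁰(X, ⋀ᵖ (T / vertical)ᵛ (k))` of global `p`-forms along `X` twisted by `𝒪_X(k)`. It consists of the
families of alternating forms on the spaces `T A` which vanish on vertical vectors, have weight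
`det ^ k`, and are holomorphic, i.e. locally induced by a form with holomorphic coefficients on
the ambient space. -/
def Forms {σ : Sec s l a} (T : FrameX σ → Submodule ℂ (Tup s l × ℂ)) (p : ℕ) (k : ℤ) :
    Submodule ℂ ((A : FrameX σ) → (T A) [⋀^Fin p]→ₗ[ℂ] ℂ) where
  carrier := {ω |
    (∀ (A : FrameX σ) (v : Fin p → T A) (i : Fin p) (Y : Matrix (Fin s) (Fin s) ℂ),
      (v i : Tup s l × ℂ) = (act Y A.1, 0) → ω A v = 0) ∧
    (∀ (g : Matrix.GeneralLinearGroup (Fin s) ℂ) (A B : FrameX σ),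
      B.1 = act (g : Matrix (Fin s) (Fin s) ℂ) A.1 →
      ∀ (v : Fin p → T A) (w : Fin p → T B),
        (∀ i, (w i : Tup s l × ℂ) = act₂ (g : Matrix (Fin s) (Fin s) ℂ) (v i)) →
        ω B w = (g : Matrix (Fin s) (Fin s) ℂ).det ^ k * ω A v) ∧
    (∀ A₀ : FrameX σ, ∃ U : Set (Tup s l), IsOpen U ∧ A₀.1 ∈ U ∧
      ∃ α : Tup s l → (Tup s l × ℂ) [⋀^Fin p]→ₗ[ℂ] ℂ,
        (∀ v, AnalyticOnNhd ℂ (fun A => α A v) U) ∧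
        ∀ A : FrameX σ, A.1 ∈ U → ∀ v : Fin p → T A, ω A v = α A.1 (fun i => (v i).1))}
  zero_mem' := by
    refine ⟨fun _ _ _ _ _ => rfl, fun _ _ _ _ _ _ _ => by simp, fun A₀ => ?_⟩
    exact ⟨Set.univ, isOpen_univ, trivial, 0, fun v => analyticOnNhd_const,
      fun _ _ _ => rfl⟩
  add_mem' := by
    rintro ω η ⟨h1, h2, h3⟩ ⟨h1', h2', h3'⟩
    refine ⟨fun A v i Y h => ?_, fun g A B hB v w hw => ?_, fun A₀ => ?_⟩
    · simp [h1 A v i Y h, h1' A v i Y h]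
    · simp only [Pi.add_apply, AlternatingMap.add_apply, h2 g A B hB v w hw,
        h2' g A B hB v w hw]
      ring
    · obtain ⟨U, hU, hA, α, hα, hr⟩ := h3 A₀
      obtain ⟨U', hU', hA', α', hα', hr'⟩ := h3' A₀
      refine ⟨U ∩ U', hU.inter hU', ⟨hA, hA'⟩, α + α', fun v => ?_, fun A h v => ?_⟩
      · exact ((hα v).mono Set.inter_subset_left).add ((hα' v).mono Set.inter_subset_right)
      · simp [hr A h.1 v, hr' A h.2 v]
  smul_mem' := by
    rintro c ω ⟨h1, h2, h3⟩
    refine ⟨fun A v i Y h => ?_, fun g A B hB v w hw => ?_, fun A₀ => ?_⟩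
    · simp [h1 A v i Y h]
    · simp only [Pi.smul_apply, AlternatingMap.smul_apply, smul_eq_mul, h2 g A B hB v w hw]
      ring
    · obtain ⟨U, hU, hA, α, hα, hr⟩ := h3 A₀
      refine ⟨U, hU, hA, c • α, fun v => analyticOnNhd_const.smul (hα v), fun A h v => ?_⟩
      simp [hr A h v]

/-- Pull-back of twisted forms along an endomorphism `P` of the ambient tangent space which commutes
with `GL_s`, fixes the vertical vectors and maps `T A` to `T' A`. -/
def pull {σ : Sec s l a} {T T' : FrameX σ → Submodule ℂ (Tup s l × ℂ)}
    (P : (Tup s l × ℂ) →ₗ[ℂ] (Tup s l × ℂ)) (hg : ∀ g v, P (act₂ g v) = act₂ g (P v))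
    (hv : ∀ H : Tup s l, P (H, 0) = (H, 0)) (hT : ∀ A, ∀ v ∈ T A, P v ∈ T' A) (p : ℕ) (k : ℤ) :
    Forms T' p k →ₗ[ℂ] Forms T p k where
  toFun ω := ⟨fun A => (ω.1 A).compLinearMap (P.restrict (hT A)), by
    obtain ⟨ω, h1, h2, h3⟩ := ω
    refine ⟨fun A v i Y h => ?_, fun g A B hB v w hw => ?_, fun A₀ => ?_⟩
    · refine h1 A _ i Y ?_
      simp [LinearMap.restrict_apply, h, hv]
    · refine h2 g A B hB _ _ fun i => ?_
      simp [LinearMap.restrict_apply, hw, hg]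
    · obtain ⟨U, hU, hA, α, hα, hr⟩ := h3 A₀
      exact ⟨U, hU, hA, fun A => (α A).compLinearMap P, fun v => hα _,
        fun A h v => hr A h _⟩⟩
  map_add' _ _ := rfl
  map_smul' _ _ := rfl

theorem tanX_le_tanG (σ : Sec s l a) (A : FrameX σ) : tanX σ A ≤ tanG σ A :=
  inf_le_right

theorem fderiv_def (σ R : Sec s l a) (A : FrameX σ) (v : Tup s l × ℂ) :
    fderiv ℂ (fun q : Tup s l × ℂ => σ.1 q.1 + q.2 * R.1 q.1) (A.1, 0) v =
      fderiv ℂ σ.1 A.1 v.1 + v.2 * R.1 A.1 := by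
  have hA : LinearIndependent ℂ A.1 := A.2.1
  have h1 : HasFDerivAt σ.1 (fderiv ℂ σ.1 A.1) ((A.1, (0 : ℂ)) : Tup s l × ℂ).1 :=
    (σ.2.2.1 _ hA).differentiableAt.hasFDerivAt
  have h2 : HasFDerivAt R.1 (fderiv ℂ R.1 A.1) ((A.1, (0 : ℂ)) : Tup s l × ℂ).1 :=
    (R.2.2.1 _ hA).differentiableAt.hasFDerivAt
  have h := (h1.comp _ hasFDerivAt_fst).add
    ((hasFDerivAt_snd (p := ((A.1, (0 : ℂ)) : Tup s l × ℂ))).mul (h2.comp _ hasFDerivAt_fst))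
  have h' := h.fderiv
  have e : (fun q : Tup s l × ℂ => σ.1 q.1 + q.2 * R.1 q.1) =
    (σ.1 ∘ Prod.fst + fun y : Tup s l × ℂ => y.2 * (R.1 ∘ Prod.fst) y) := rfl
  rw [e]
  erw [h']
  simp [mul_comm]

theorem tanX_le_tanDef (σ R : Sec s l a) (A : FrameX σ) : tanX σ A ≤ tanDef σ R A := by
  rintro v ⟨h1, h2⟩
  have h1' : fderiv ℂ σ.1 A.1 v.1 = 0 := h1
  have h2' : v.2 = 0 := h2
  show fderiv ℂ (fun q : Tup s l × ℂ => σ.1 q.1 + q.2 * R.1 q.1) (A.1, 0) v = 0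
  rw [fderiv_def, h1', h2']
  simp

/-- The restriction of forms induced by an inclusion `X ⊆ Z`, `T` being tangent to `Z`: the surjection
`⋀ᵖ Ω¹_Z|X (k) → Ωᵖ_X (k)` on global sections. -/
noncomputable def restr {σ : Sec s l a} {T : FrameX σ → Submodule ℂ (Tup s l × ℂ)}
    (hT : ∀ A, tanX σ A ≤ T A) (p : ℕ) (k : ℤ) : Forms T p k →ₗ[ℂ] Forms (tanX σ) p k :=
  pull LinearMap.id (fun _ _ => rfl) (fun _ => rfl) (fun A _ hv => hT A hv) p k

/-- The map `φ : Ω¹_𝔾|X (k) → Ω¹_𝒳|X (k)` given by the splitting of the extension pulled back to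
`Ω¹_𝔾|X (k)`, and its exterior powers, on global sections: pull-back of forms along the projection
`𝒳 ⊆ 𝔾 × Spec ℂ[t] → 𝔾`, whose differential is `(H, τ) ↦ (H, 0)`. -/
noncomputable def phi (σ R : Sec s l a) (p : ℕ) (k : ℤ) :
    Forms (tanG σ) p k →ₗ[ℂ] Forms (tanDef σ R) p k :=
  pull (LinearMap.inl ℂ (Tup s l) ℂ ∘ₗ LinearMap.fst ℂ (Tup s l) ℂ)
    (fun g v => by simp [act₂]) (fun _ => rfl) (fun _ _ _ => by simp [tanG]) p k

/-- Multiplication of twisted forms by the restriction to `X` of a section `R` of `𝒪(m)`. -/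
def mulSec {σ : Sec s l a} {T : FrameX σ → Submodule ℂ (Tup s l × ℂ)} {m : ℤ} (R : Sec s l m)
    (p : ℕ) {k k' : ℤ} (hk : k' = m + k) : Forms T p k →ₗ[ℂ] Forms T p k' where
  toFun ω := ⟨fun A => R.1 A.1 • ω.1 A, by
    obtain ⟨ω, h1, h2, h3⟩ := ω
    have ho : IsOpen {A : Tup s l | LinearIndependent ℂ A} := isOpen_setOfPred_linearIndependent
    refine ⟨fun A v i Y h => ?_, fun g A B hB v w hw => ?_, fun A₀ => ?_⟩
    · simp [h1 A v i Y h]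
    · have hd : (g : Matrix (Fin s) (Fin s) ℂ).det ≠ 0 := g.det.ne_zero
      simp only [AlternatingMap.smul_apply, smul_eq_mul, h2 g A B hB v w hw, hk, hB,
        R.2.2.2 g A.1 A.2.1, zpow_add₀ hd]
      ring
    · obtain ⟨U, hU, hA, α, hα, hr⟩ := h3 A₀
      refine ⟨U ∩ {A | LinearIndependent ℂ A}, hU.inter ho, ⟨hA, A₀.2.1⟩,
        fun A => R.1 A • α A, fun v => ?_, fun A h v => ?_⟩
      · exact (R.2.2.1.mono Set.inter_subset_right).mul ((hα v).mono Set.inter_subset_left)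
      · simp [hr A h.1 v]⟩
  map_add' ω η := by
    ext A v
    simp
  map_smul' c ω := by
    ext A v
    simp [mul_left_comm]

/-- The twisted `N`-form `η₁ ∧ ⋯ ∧ η_N` of twisted one-forms `ηᵢ`:
`(η₁ ∧ ⋯ ∧ η_N)(v₁, …, v_N) = det (ηᵢ(vⱼ))`. -/
noncomputable def wedge {σ : Sec s l a} {T : FrameX σ → Submodule ℂ (Tup s l × ℂ)} {N : ℕ} {k : ℤ}
    (η : Fin N → Forms T 1 k) : Forms T N (N * k) :=
  ⟨fun A => Matrix.detRowAlternating.compLinearMap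
      (LinearMap.pi fun i => (AlternatingMap.ofSubsingleton ℂ (T A) ℂ (0 : Fin 1)).symm
        ((η i).1 A)), by
    refine ⟨fun A v i Y h => ?_, fun g A B hB v w hw => ?_, fun A₀ => ?_⟩
    · refine Matrix.det_eq_zero_of_row_eq_zero i fun j => ?_
      exact (η j).2.1 A (fun _ => v i) 0 Y h
    · have h : (Matrix.of fun i j => (η j).1 B (fun _ => w i)) =
          ((g : Matrix (Fin s) (Fin s) ℂ).det ^ k) •
            (Matrix.of fun i j => (η j).1 A (fun _ => v i)) := by
        ext i j
        exact (η j).2.2.1 g A B hB (fun _ => v i) (fun _ => w i) (fun _ => hw i)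
      have h' := congrArg Matrix.det h
      rw [Matrix.det_smul, Fintype.card_fin, ← zpow_natCast, ← zpow_mul, mul_comm k] at h'
      exact h'
    · choose U hU hA α hα hr using fun i => (η i).2.2.2 A₀
      refine ⟨⋂ i, U i, isOpen_iInter_of_finite hU, Set.mem_iInter.2 hA,
        fun A => Matrix.detRowAlternating.compLinearMap
          (LinearMap.pi fun i => (AlternatingMap.ofSubsingleton ℂ (Tup s l × ℂ) ℂ
            (0 : Fin 1)).symm (α i A)), fun v => ?_, fun A h v => ?_⟩
      · have : (fun A => (Matrix.detRowAlternating.compLinearMap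
          (LinearMap.pi fun i => (AlternatingMap.ofSubsingleton ℂ (Tup s l × ℂ) ℂ
            (0 : Fin 1)).symm (α i A))) v) =
            fun A => ∑ τ : Equiv.Perm (Fin N), (Equiv.Perm.sign τ : ℂ) *
              ∏ i, α i A (fun _ => v (τ i)) := by
          funext A
          exact Matrix.det_apply' _
        rw [this]
        refine Finset.analyticOnNhd_fun_sum _ fun τ _ => ?_
        refine analyticOnNhd_const.mul ?_
        exact Finset.analyticOnNhd_fun_prod _ fun i _ =>
          (hα i fun _ => v (τ i)).mono (Set.iInter_subset _ i)
      · have e : (Matrix.of fun i j => (η j).1 A (fun _ => v i)) =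
            Matrix.of fun i j => α j A.1 (fun _ => (v i).1) := by
          ext i j
          exact hr j A (Set.mem_iInter.1 h j) _
        exact congrArg Matrix.det e⟩

/-- Let `0 → L → E → Ω¹_X → 0` be exact, `E` being the dual of `T / vertical` and `L` the line
subbundle generated by the (nowhere vanishing on `T`) linear forms `gen A`. This says that `e` is the
induced identification `det E ≅ L ⊗ Ωⁿ_X`, namely `gen ∧ β̃ ↦ β` for `β̃` a lift of `β`. -/
def IsDetIso {σ : Sec s l a} {T : FrameX σ → Submodule ℂ (Tup s l × ℂ)}
    (hT : ∀ A, tanX σ A ≤ T A) (gen : FrameX σ → Tup s l × ℂ → ℂ) {n : ℕ} {k k' : ℤ}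
    (e : Forms T (n + 1) k ≃ₗ[ℂ] Forms (tanX σ) n k') : Prop :=
  ∀ (ω : Forms T (n + 1) k) (A : FrameX σ) (u : T A) (v : Fin n → tanX σ A),
    ω.1 A (Fin.cons u fun i => Submodule.inclusion (hT A) (v i)) = gen A u * (e ω).1 A v

end

end GrassAdjoint

open GrassAdjoint

/-!
Both exact sequences have the form `0 → L → E → Ω¹_X → 0`, where `E` is the dual of `T / vertical` for
a family `T` of tangent spaces containing that of `X`, and `L` is generated by a linear form `γ` whose
zeros in `T` are the tangent vectors of `X` (`IsLineGenerator`): `γ = dσ`, of weight `det ^ a`, for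
`𝔾`, and `γ = -dt`, which is `GL_s`-invariant, for the deformation `𝒳`.

In this situation a global section `ω` of `det E` is contracted with any vector `u` such that
`γ u = 1`. Two choices of `u` differ by a tangent vector of `X`, and a form of degree `n + 1` vanishes
on the `n`-dimensional `X` (`form_tanX_eq_zero`); so the result `β` does not depend on `u`, hence it is
equivariant, and it is holomorphic because `u` can be chosen holomorphically near each frame. The
inverse is `β ↦ γ ∧ β̃`. Injectivity, the equivariance of `γ ∧ β̃`, and the comparison of its local
holomorphic descriptions all rest on the fact that a form of degree `n + 1` is determined by its values
on one vector of `T` followed by vectors of the hyperplane `γ = 0` (`ext_of_cons_ker`).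

The equation `dσ + R dt = 0` of the tangent spaces of `𝒳` along `X` turns `dσ` into `R · (-dt)`, so
under the two isomorphisms pull-back along `𝒳 → 𝔾` is multiplication by `R` (`isDetIso_phi`). The
projection `𝒳 → 𝔾` restricts to the identity of `X`, and pull-back commutes with exterior products;
this gives the compatibility with restriction and the relation between the adjoint forms.
-/

namespace GrassAdjoint

/-! ### Alternating forms and a hyperplane -/

section Alternating
variable {M : Type*} [AddCommGroup M] [Module ℂ M] {n : ℕ}

/-- A form annihilated by the contraction with `u` does not see translations along `u`. -/
theorem map_sub_smul_of_contraction_eq_zero {ι : Type*} [Fintype ι] [DecidableEq ι]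
    (f : M [⋀^ι]→ₗ[ℂ] ℂ) (u : M) (h : ∀ v i, v i = u → f v = 0) (c : ι → ℂ) (v : ι → M) :
    f (fun i => v i - c i • u) = f v := by
  have e : (fun i => v i - c i • u) = v + fun i => (-c i) • u := by
    funext i
    simp [sub_eq_add_neg]
  rw [e, f.map_add_univ, Finset.sum_eq_single Finset.univ]
  · simp
  · intro t _ ht
    obtain ⟨i, hi⟩ : ∃ i, i ∉ t := by simpa [Finset.eq_univ_iff_forall] using ht
    generalize hw : t.piecewise v (fun i => (-c i) • u) = w
    have hwi : w i = (-c i) • u := by simp [← hw, hi]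
    rw [← Function.update_eq_self i w, hwi, f.map_update_smul, h _ i (by simp), smul_zero]
  · simp

/-- An alternating `(n + 1)`-form is determined by its values on the tuples whose last `n` entries
lie in a given hyperplane `γ = 0`. -/
theorem ext_of_cons_ker {γ : M →ₗ[ℂ] ℂ} {u₀ : M} (hu₀ : γ u₀ = 1)
    {f g : M [⋀^Fin (n + 1)]→ₗ[ℂ] ℂ}
    (h : ∀ (u : M) (v : Fin n → M), (∀ i, γ (v i) = 0) → f (Fin.cons u v) = g (Fin.cons u v)) :
    f = g := by
  rw [← sub_eq_zero]
  replace h : ∀ (u : M) (v : Fin n → M), (∀ i, γ (v i) = 0) → (f - g) (Fin.cons u v) = 0 :=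
    fun u v hv => by simp [h u v hv]
  generalize f - g = f at h ⊢
  have hπ : ∀ x, γ (x - γ x • u₀) = 0 := fun x => by simp [hu₀]
  -- Contract with `u₀`: the contraction is a form on `M / u₀`, which is the hyperplane.
  have hc : ∀ v : Fin n → M, f (Fin.cons u₀ v) = 0 := by
    intro v
    have := map_sub_smul_of_contraction_eq_zero (f.curryLeft u₀) u₀
      (fun w i hw => f.map_eq_zero_of_eq _ (i := 0) (j := i.succ) (by simp [hw])
        (Fin.succ_ne_zero i).symm) (fun i => γ (v i)) v
    exact this.symm.trans (h _ _ fun i => hπ _)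
  have hc' : ∀ (v : Fin (n + 1) → M) (i : Fin (n + 1)), v i = u₀ → f v = 0 := by
    intro v i hi
    have := f.map_insertNth i u₀ (i.removeNth v)
    rw [← hi, Fin.insertNth_self_removeNth, hi] at this
    rw [this]
    exact (congrArg _ (hc _)).trans (smul_zero _)
  ext v
  rw [← map_sub_smul_of_contraction_eq_zero f u₀ hc' (fun i => γ (v i)) v,
    ← Fin.cons_self_tail (fun i => v i - γ (v i) • u₀)]
  exact h _ _ fun i => hπ _

/-- The exterior product `γ ∧ β` of a linear form and an alternating form. -/
noncomputable def linWedge (γ : M →ₗ[ℂ] ℂ) (β : M [⋀^Fin n]→ₗ[ℂ] ℂ) : M [⋀^Fin (n + 1)]→ₗ[ℂ] ℂ :=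
  AlternatingMap.alternatizeUncurryFin (γ.smulRight β)

theorem linWedge_apply (γ : M →ₗ[ℂ] ℂ) (β : M [⋀^Fin n]→ₗ[ℂ] ℂ) (v : Fin (n + 1) → M) :
    linWedge γ β v = ∑ i : Fin (n + 1), (-1) ^ (i : ℕ) * (γ (v i) * β (i.removeNth v)) := by
  simp [linWedge, AlternatingMap.alternatizeUncurryFin_apply]

theorem linWedge_cons (γ : M →ₗ[ℂ] ℂ) (β : M [⋀^Fin n]→ₗ[ℂ] ℂ) (u : M) (v : Fin n → M)
    (hv : ∀ i, γ (v i) = 0) : linWedge γ β (Fin.cons u v) = γ u * β v := by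
  rw [linWedge_apply, Fin.sum_univ_succ]
  simp [hv, Fin.removeNth_zero]

/-- A form vanishing whenever one of its arguments lies in `V` is zero if its degree exceeds the
codimension of `V`. -/
theorem eq_zero_of_finrank_lt {p : ℕ} [FiniteDimensional ℂ M] (V : Submodule ℂ M)
    (f : M [⋀^Fin p]→ₗ[ℂ] ℂ) (h : ∀ v i, v i ∈ V → f v = 0)
    (hp : Module.finrank ℂ M < Module.finrank ℂ V + p) : f = 0 := by
  ext v
  have hq := V.finrank_quotient_add_finrank
  have hd : ¬ LinearIndependent ℂ (fun i => V.mkQ (v i)) := fun hli => by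
    have := hli.fintype_card_le_finrank
    simp only [Fintype.card_fin] at this
    omega
  obtain ⟨c, hc, j, hj⟩ := Fintype.not_linearIndependent_iff.1 hd
  have hm : ∑ i, c i • v i ∈ V := by
    rw [← V.ker_mkQ, LinearMap.mem_ker]
    simpa using hc
  have h0 := h (Function.update v j (∑ i, c i • v i)) j (by simpa using hm)
  rw [f.map_update_sum, Finset.sum_eq_single j, f.map_update_smul, Function.update_eq_self] at h0
  · simpa [hj] using h0
  · intro i _ hij
    rw [f.map_update_smul, f.map_update_self _ hij.symm, smul_zero]
  · simp

/-- Inserting a holomorphic vector field into a holomorphic family of forms. -/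
theorem analyticOnNhd_cons {E F : Type*} [NormedAddCommGroup E] [NormedSpace ℂ E]
    [NormedAddCommGroup F] [NormedSpace ℂ F] [FiniteDimensional ℂ F] {U : Set E}
    {α : E → F [⋀^Fin (n + 1)]→ₗ[ℂ] ℂ} (hα : ∀ v, AnalyticOnNhd ℂ (fun A => α A v) U)
    {u : E → F} (hu : AnalyticOnNhd ℂ u U) (v : Fin n → F) :
    AnalyticOnNhd ℂ (fun A => α A (Fin.cons (u A) v)) U := by
  let b := Module.finBasis ℂ F
  have e : (fun A => α A (Fin.cons (u A) v)) =
      fun A => ∑ i, b.coord i (u A) * α A (Fin.cons (b i) v) := by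
    funext A
    let ev : F →ₗ[ℂ] ℂ :=
      { toFun := fun x => (α A).curryLeft x v
        map_add' := fun x y => by simp
        map_smul' := fun c x => by simp }
    have h := congrArg ev (b.sum_repr (u A))
    simp only [map_sum, map_smul] at h
    exact h.symm
  rw [e]
  refine Finset.analyticOnNhd_fun_sum _ fun i _ => AnalyticOnNhd.mul ?_ (hα _)
  exact fun A hA => ((b.coord i).toContinuousLinearMap.analyticAt _).comp (hu A hA)

end Alternating

/-! ### The differential of a section of `𝒪(a)` -/

section Geometry
variable {s l : ℕ} {a : ℤ}

theorem FrameX.linearIndependent {σ : Sec s l a} (A : FrameX σ) : LinearIndependent ℂ A.1 := A.2.1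

theorem FrameX.apply_eq_zero {σ : Sec s l a} (A : FrameX σ) : σ.1 A.1 = 0 :=
  A.2.2 _ A.2.1 rfl

theorem differentiableAt_sec (σ : Sec s l a) {A : Tup s l} (hA : LinearIndependent ℂ A) :
    DifferentiableAt ℂ σ.1 A :=
  (σ.2.2.1 _ hA).differentiableAt

theorem analyticOnNhd_fderiv_sec (σ : Sec s l a) (H : Tup s l) :
    AnalyticOnNhd ℂ (fun A => fderiv ℂ σ.1 A H) {A | LinearIndependent ℂ A} :=
  fun A hA => ((ContinuousLinearMap.apply ℂ ℂ H).analyticAt _).comp (σ.2.2.1.fderiv A hA)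

theorem eventually_linearIndependent {A : Tup s l} (hA : LinearIndependent ℂ A) :
    ∀ᶠ B in nhds A, LinearIndependent ℂ B :=
  (isOpen_setOfPred_linearIndependent (𝕜 := ℂ) (E := Fin (l + 1) → ℂ)).mem_nhds hA

theorem act_one (A : Tup s l) : act 1 A = A := by
  funext i
  simp [act, Matrix.one_apply]

theorem act_add (g h : Matrix (Fin s) (Fin s) ℂ) (A : Tup s l) :
    act (g + h) A = act g A + act h A := by
  funext i
  simp [act, add_smul, Finset.sum_add_distrib]

theorem act_smul (c : ℂ) (g : Matrix (Fin s) (Fin s) ℂ) (A : Tup s l) :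
    act (c • g) A = c • act g A := by
  funext i
  simp [act, Finset.smul_sum, smul_smul]

/-- Since `σ` is an eigenfunction of `GL_s` and vanishes at the points of `X`, its differential
vanishes there on the tangent vectors of the `GL_s`-orbits. -/
theorem fderiv_act_self {σ : Sec s l a} (A : FrameX σ) (Y : Matrix (Fin s) (Fin s) ℂ) :
    fderiv ℂ σ.1 A.1 (act Y A.1) = 0 := by
  -- The line `A + t (Y A) = (1 + t Y) A` stays in the `GL_s`-orbit of `A` for small `t`.
  have hline : HasDerivAt (fun t : ℂ => A.1 + t • act Y A.1) (act Y A.1) 0 := by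
    simpa using ((hasDerivAt_id (0 : ℂ)).smul_const (act Y A.1)).const_add A.1
  have hσ : HasFDerivAt σ.1 (fderiv ℂ σ.1 A.1) (A.1 + (0 : ℂ) • act Y A.1) := by
    simpa using (differentiableAt_sec σ A.linearIndependent).hasFDerivAt
  have hcomp := hσ.comp_hasDerivAt (0 : ℂ) hline
  have hdet : ∀ᶠ t : ℂ in nhds 0, (1 + t • Y).det ≠ 0 := by
    have hc : Continuous fun t : ℂ => (1 + t • Y).det := by fun_prop
    exact hc.continuousAt.eventually_ne (by simp)
  have hzero : (σ.1 ∘ fun t : ℂ => A.1 + t • act Y A.1) =ᶠ[nhds 0] fun _ => (0 : ℂ) := by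
    filter_upwards [hdet] with t ht
    have h := σ.2.2.2 (Matrix.GeneralLinearGroup.mkOfDetNeZero _ ht) A.1 A.linearIndependent
    rw [A.apply_eq_zero, mul_zero] at h
    have e : act (1 + t • Y) A.1 = A.1 + t • act Y A.1 := by rw [act_add, act_one, act_smul]
    rw [Function.comp_apply, ← e]
    exact h
  exact hcomp.unique ((hasDerivAt_const (0 : ℂ) (0 : ℂ)).congr_of_eventuallyEq hzero)

theorem fderiv_act (σ : Sec s l a) (g : Matrix.GeneralLinearGroup (Fin s) ℂ) {A B : Tup s l}
    (hA : LinearIndependent ℂ A) (hB : LinearIndependent ℂ B)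
    (hAB : B = act (g : Matrix (Fin s) (Fin s) ℂ) A) (H : Tup s l) :
    fderiv ℂ σ.1 B (act (g : Matrix (Fin s) (Fin s) ℂ) H) =
      (g : Matrix (Fin s) (Fin s) ℂ).det ^ a * fderiv ℂ σ.1 A H := by
  subst hAB
  let L := (act (s := s) (l := l) (g : Matrix (Fin s) (Fin s) ℂ)).toContinuousLinearMap
  have h1 : HasFDerivAt (σ.1 ∘ L) ((fderiv ℂ σ.1 (L A)).comp L) A :=
    (differentiableAt_sec σ hB).hasFDerivAt.comp A L.hasFDerivAt
  have h2 := (differentiableAt_sec σ hA).hasFDerivAt.const_mul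
    ((g : Matrix (Fin s) (Fin s) ℂ).det ^ a)
  have h3 : (σ.1 ∘ L) =ᶠ[nhds A] fun B => (g : Matrix (Fin s) (Fin s) ℂ).det ^ a * σ.1 B := by
    filter_upwards [eventually_linearIndependent hA] with B hB
    exact σ.2.2.2 g B hB
  have h4 := (h2.congr_of_eventuallyEq h3).unique h1
  have h5 := congrArg (fun f => f H) h4
  simpa [L] using h5.symm

/-! ### The tangent spaces -/

/-- The vertical vectors: tangent vectors of the `GL_s`-orbit of `A`. -/
noncomputable def vert (A : Tup s l) : Matrix (Fin s) (Fin s) ℂ →ₗ[ℂ] Tup s l × ℂ where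
  toFun Y := (act Y A, 0)
  map_add' Y Z := by simp [act_add]
  map_smul' c Y := by simp [act_smul]

theorem vert_injective {A : Tup s l} (hA : LinearIndependent ℂ A) :
    Function.Injective (vert A) := by
  rw [← LinearMap.ker_eq_bot, LinearMap.ker_eq_bot']
  intro Y hY
  ext i j
  have h : ∑ j, Y i j • A j = 0 := congrFun (congrArg Prod.fst hY) i
  exact Fintype.linearIndependent_iff.1 hA _ h j

theorem mem_tanX {σ : Sec s l a} {A : FrameX σ} {v : Tup s l × ℂ} :
    v ∈ tanX σ A ↔ fderiv ℂ σ.1 A.1 v.1 = 0 ∧ v.2 = 0 := Iff.rfl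

theorem mem_tanDef {σ R : Sec s l a} {A : FrameX σ} {v : Tup s l × ℂ} :
    v ∈ tanDef σ R A ↔ fderiv ℂ σ.1 A.1 v.1 + v.2 * R.1 A.1 = 0 := by
  rw [← fderiv_def]
  rfl

theorem vert_mem_tanX {σ : Sec s l a} (A : FrameX σ) (Y : Matrix (Fin s) (Fin s) ℂ) :
    vert A.1 Y ∈ tanX σ A :=
  mem_tanX.2 ⟨fderiv_act_self A Y, rfl⟩

theorem act₂_mem_tanX {σ : Sec s l a} (g : Matrix.GeneralLinearGroup (Fin s) ℂ) {A B : FrameX σ}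
    (hB : B.1 = act (g : Matrix (Fin s) (Fin s) ℂ) A.1) {v : Tup s l × ℂ} (hv : v ∈ tanX σ A) :
    act₂ (g : Matrix (Fin s) (Fin s) ℂ) v ∈ tanX σ B := by
  refine mem_tanX.2 ⟨?_, hv.2⟩
  have h := fderiv_act σ g A.linearIndependent B.linearIndependent hB v.1
  rw [(mem_tanX.1 hv).1, mul_zero] at h
  exact h

theorem finrank_tanX {σ : Sec s l a} (hσ : SmoothDivisor σ) (A : FrameX σ) :
    Module.finrank ℂ (tanX σ A) + 1 = s * (l + 1) := by
  let f : Tup s l →ₗ[ℂ] ℂ := (fderiv ℂ σ.1 A.1).toLinearMap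
  have hf : f ≠ 0 := fun h => hσ A (ContinuousLinearMap.coe_injective h)
  have hmap : tanX σ A = f.ker.map (LinearMap.inl ℂ (Tup s l) ℂ) := by
    ext v
    constructor
    · rintro ⟨h1, h2⟩
      exact ⟨v.1, h1, Prod.ext rfl (Eq.symm h2)⟩
    · rintro ⟨H, hH, rfl⟩
      exact mem_tanX.2 ⟨hH, rfl⟩
  rw [hmap, ← (Submodule.equivMapOfInjective _ LinearMap.inl_injective f.ker).finrank_eq,
    Module.Dual.finrank_ker_add_one_of_ne_zero hf]
  simp [Module.finrank_pi_fintype]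

/-- `X` has dimension `n`: there is no nonzero form of degree `n + 1` on it. -/
theorem form_tanX_eq_zero {n : ℕ} {σ : Sec s l a} (hσ : SmoothDivisor σ) (hsl : s ≤ l)
    (hn : n + 1 = s * (l + 1 - s)) (A : FrameX σ) (f : (tanX σ A) [⋀^Fin (n + 1)]→ₗ[ℂ] ℂ)
    (h : ∀ (v : Fin (n + 1) → tanX σ A) (i) (Y : Matrix (Fin s) (Fin s) ℂ),
      (v i : Tup s l × ℂ) = (act Y A.1, 0) → f v = 0) : f = 0 := by
  let V : Matrix (Fin s) (Fin s) ℂ →ₗ[ℂ] tanX σ A := (vert A.1).codRestrict _ (vert_mem_tanX A)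
  have hV : Function.Injective V := fun Y Z hYZ =>
    vert_injective A.linearIndependent (congrArg Subtype.val hYZ)
  refine eq_zero_of_finrank_lt V.range f ?_ ?_
  · rintro v i ⟨Y, hY⟩
    exact h v i Y (congrArg Subtype.val hY).symm
  · have h1 := finrank_tanX hσ A
    rw [LinearMap.finrank_range_of_inj hV, Module.finrank_matrix]
    simp only [Fintype.card_fin, Module.finrank_self, mul_one]
    obtain ⟨k, rfl⟩ := Nat.exists_eq_add_of_le hsl
    have e : s + k + 1 - s = k + 1 := by omega
    rw [e] at hn
    have : s * (s + k + 1) = s * s + s * (k + 1) := by ring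
    omega

end Geometry

/-! ### The determinant isomorphism of a line subbundle with a generator -/

section Determinant
variable {s l : ℕ} {a : ℤ} {σ : Sec s l a} {T : FrameX σ → Submodule ℂ (Tup s l × ℂ)}
  {γ : Tup s l → (Tup s l × ℂ) →ₗ[ℂ] ℂ} {m : ℤ}

/-- `0 → 𝒪_X(-m) → (T / vertical)ᵛ → Ω¹_X → 0` is exact, the line subbundle being generated by the
equivariant holomorphic family `γ` of linear forms of weight `det ^ m`. Exactness says that the
tangent vectors of `X` are the zeros of `γ` in `T`, and that `γ` takes the value `1` on local
holomorphic sections of `T`. -/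
structure IsLineGenerator (T : FrameX σ → Submodule ℂ (Tup s l × ℂ))
    (γ : Tup s l → (Tup s l × ℂ) →ₗ[ℂ] ℂ) (m : ℤ) : Prop where
  le : ∀ A, tanX σ A ≤ T A
  mem_tanX_iff : ∀ (A : FrameX σ) (v : Tup s l × ℂ), v ∈ T A → (v ∈ tanX σ A ↔ γ A.1 v = 0)
  act_mem : ∀ (g : Matrix.GeneralLinearGroup (Fin s) ℂ) (A B : FrameX σ),
    B.1 = act (g : Matrix (Fin s) (Fin s) ℂ) A.1 → ∀ v ∈ T A,
      act₂ (g : Matrix (Fin s) (Fin s) ℂ) v ∈ T B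
  apply_act : ∀ (g : Matrix.GeneralLinearGroup (Fin s) ℂ) (A B : FrameX σ),
    B.1 = act (g : Matrix (Fin s) (Fin s) ℂ) A.1 → ∀ v,
      γ B.1 (act₂ (g : Matrix (Fin s) (Fin s) ℂ) v) =
        (g : Matrix (Fin s) (Fin s) ℂ).det ^ m * γ A.1 v
  analytic : ∀ v, AnalyticOnNhd ℂ (fun A => γ A v) {A | LinearIndependent ℂ A}
  exists_section : ∀ A₀ : FrameX σ, ∃ U : Set (Tup s l), IsOpen U ∧ A₀.1 ∈ U ∧
    ∃ u : Tup s l → Tup s l × ℂ, AnalyticOnNhd ℂ u U ∧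
      ∀ A : FrameX σ, A.1 ∈ U → u A.1 ∈ T A ∧ γ A.1 (u A.1) = 1

namespace IsLineGenerator

theorem exists_apply_eq_one (h : IsLineGenerator T γ m) (A : FrameX σ) :
    ∃ u : T A, γ A.1 u = 1 := by
  obtain ⟨U, -, hA, u, -, hu⟩ := h.exists_section A
  exact ⟨⟨u A.1, (hu A hA).1⟩, (hu A hA).2⟩

/-- A tangent vector along which the generator is normalized to `1`. -/
noncomputable def normal (h : IsLineGenerator T γ m) (A : FrameX σ) : T A :=
  (h.exists_apply_eq_one A).choose

theorem apply_normal (h : IsLineGenerator T γ m) (A : FrameX σ) : γ A.1 (h.normal A) = 1 :=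
  (h.exists_apply_eq_one A).choose_spec

/-- Contraction of top forms with any vector `u` depends only on the value of the generator at
`u`: two such vectors with the same value differ by a tangent vector of `X`, and `n + 1` tangent
vectors of the `n`-dimensional `X` are dependent. -/
theorem apply_cons (h : IsLineGenerator T γ m) (hσ : SmoothDivisor σ) (hsl : s ≤ l) {n : ℕ}
    (hn : n + 1 = s * (l + 1 - s)) {k : ℤ} (ω : Forms T (n + 1) k) {A : FrameX σ} (u u' : T A)
    (hu' : γ A.1 u' = 1) (v : Fin n → tanX σ A) :
    ω.1 A (Fin.cons u fun i => Submodule.inclusion (h.le A) (v i)) =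
      γ A.1 u * ω.1 A (Fin.cons u' fun i => Submodule.inclusion (h.le A) (v i)) := by
  have hx : (u - γ A.1 u • u' : Tup s l × ℂ) ∈ tanX σ A :=
    (h.mem_tanX_iff A _ (u - γ A.1 u • u').2).2 (by simp [hu'])
  have h0 : (ω.1 A).compLinearMap (Submodule.inclusion (h.le A)) = 0 :=
    form_tanX_eq_zero hσ hsl hn A _ fun w i Y hw => ω.2.1 A _ i Y hw
  have h1 := congrArg (fun f => f (Fin.cons ⟨_, hx⟩ v)) h0
  let w : Fin n → T A := fun i => Submodule.inclusion (h.le A) (v i)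
  have e : (fun i => Submodule.inclusion (h.le A)
      ((Fin.cons ⟨_, hx⟩ v : Fin (n + 1) → tanX σ A) i)) =
        (Fin.cons (u - γ A.1 u • u') w : Fin (n + 1) → T A) := by
    funext i
    refine Fin.cases rfl (fun i => rfl) i
  have h2 : (ω.1 A).curryLeft (u - γ A.1 u • u') w = 0 := by
    have h3 : ω.1 A (fun i => Submodule.inclusion (h.le A)
      ((Fin.cons ⟨_, hx⟩ v : Fin (n + 1) → tanX σ A) i)) = 0 := h1
    rw [e] at h3
    exact h3
  rw [map_sub, map_smul] at h2
  exact sub_eq_zero.1 h2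

/-- Contraction `ω ↦ ω(u, ·)` of top forms with the vectors `u` on which the generator is `1`. -/
noncomputable def contract (h : IsLineGenerator T γ m) (hσ : SmoothDivisor σ) (hsl : s ≤ l) {n : ℕ}
    (hn : n + 1 = s * (l + 1 - s)) {k k' : ℤ} (hk : k = m + k') :
    Forms T (n + 1) k →ₗ[ℂ] Forms (tanX σ) n k' where
  toFun ω := ⟨fun A => ((ω.1 A).curryLeft (h.normal A)).compLinearMap
      (Submodule.inclusion (h.le A)), by
    refine ⟨fun A v i Y hv => ?_, fun g A B hB v w hw => ?_, fun A₀ => ?_⟩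
    · refine ω.2.1 A _ i.succ Y ?_
      simpa using hv
    -- The normal vectors at `A` and `B` need not correspond; `act₂ g` maps the one at `A` to a vector
    -- on which `γ` is `det g ^ m`.
    · have hd : (g : Matrix (Fin s) (Fin s) ℂ).det ≠ 0 := g.det.ne_zero
      have hz : (g : Matrix (Fin s) (Fin s) ℂ).det ^ k =
          (g : Matrix (Fin s) (Fin s) ℂ).det ^ m * (g : Matrix (Fin s) (Fin s) ℂ).det ^ k' := by
        rw [hk, zpow_add₀ hd]
      have h1 := ω.2.2.1 g A B hB (Fin.cons (h.normal A) fun i => Submodule.inclusion (h.le A) (v i))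
        (Fin.cons ⟨_, h.act_mem g A B hB _ (h.normal A).2⟩
          fun i => Submodule.inclusion (h.le B) (w i))
        (fun i => Fin.cases rfl (fun i => hw i) i)
      rw [h.apply_cons hσ hsl hn ω _ _ (h.apply_normal B), h.apply_act g A B hB, h.apply_normal,
        mul_one, hz, mul_assoc] at h1
      exact mul_left_cancel₀ (zpow_ne_zero m hd) h1
    · obtain ⟨U, hU, hA, α, hα, hr⟩ := ω.2.2.2 A₀
      obtain ⟨U', hU', hA', u, hu, hu'⟩ := h.exists_section A₀
      refine ⟨U ∩ U', hU.inter hU', ⟨hA, hA'⟩, fun A => (α A).curryLeft (u A), fun v => ?_,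
        fun A hAU v => ?_⟩
      · exact analyticOnNhd_cons (fun v => (hα v).mono Set.inter_subset_left)
          (hu.mono Set.inter_subset_right) v
      · have h1 := h.apply_cons hσ hsl hn ω (h.normal A) ⟨_, (hu' A hAU.2).1⟩ (hu' A hAU.2).2 v
        rw [h.apply_normal, one_mul] at h1
        refine h1.trans ((hr A hAU.1 _).trans (congrArg (α A.1) ?_))
        funext i
        exact Fin.cases rfl (fun i => rfl) i⟩
  map_add' ω η := by
    ext A v
    rfl
  map_smul' c ω := by
    ext A v
    rfl

theorem apply_cons_eq_contract (h : IsLineGenerator T γ m) (hσ : SmoothDivisor σ) (hsl : s ≤ l)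
    {n : ℕ} (hn : n + 1 = s * (l + 1 - s)) {k k' : ℤ} (hk : k = m + k') (ω : Forms T (n + 1) k)
    (A : FrameX σ) (u : T A) (v : Fin n → tanX σ A) :
    ω.1 A (Fin.cons u fun i => Submodule.inclusion (h.le A) (v i)) =
      γ A.1 u * (h.contract hσ hsl hn hk ω).1 A v :=
  h.apply_cons hσ hsl hn ω u _ (h.apply_normal A) v

/-- Alternating forms on `T A` which agree on one vector of `T A` followed by tangent vectors of `X`
are equal. -/
theorem form_ext (h : IsLineGenerator T γ m) {n : ℕ} {A : FrameX σ}
    {f g : (T A) [⋀^Fin (n + 1)]→ₗ[ℂ] ℂ}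
    (hfg : ∀ (u : T A) (v : Fin n → tanX σ A),
      f (Fin.cons u fun i => Submodule.inclusion (h.le A) (v i)) =
        g (Fin.cons u fun i => Submodule.inclusion (h.le A) (v i))) : f = g :=
  ext_of_cons_ker (γ := γ A.1 ∘ₗ (T A).subtype) (h.apply_normal A) fun u v hv =>
    hfg u fun i => ⟨v i, (h.mem_tanX_iff A _ (v i).2).2 (hv i)⟩

/-- The projection of `T A` onto the tangent vectors of `X` along the chosen normal vector. -/
noncomputable def proj (h : IsLineGenerator T γ m) (A : FrameX σ) : T A →ₗ[ℂ] tanX σ A :=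
  ((T A).subtype - (γ A.1 ∘ₗ (T A).subtype).smulRight (h.normal A : Tup s l × ℂ)).codRestrict _
    fun v => (h.mem_tanX_iff A _ (v - γ A.1 v • h.normal A).2).2 (by simp [h.apply_normal])

theorem coe_proj (h : IsLineGenerator T γ m) {A : FrameX σ} (v : T A) :
    (h.proj A v : Tup s l × ℂ) = v - γ A.1 v • (h.normal A : Tup s l × ℂ) := rfl

theorem proj_inclusion (h : IsLineGenerator T γ m) {A : FrameX σ} (v : tanX σ A) :
    h.proj A (Submodule.inclusion (h.le A) v) = v := by
  ext1
  rw [coe_proj, Submodule.coe_inclusion, (h.mem_tanX_iff A v (h.le A v.2)).1 v.2, zero_smul,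
    sub_zero]

/-- The form `γ ∧ β̃` on `T A`, where `β̃` is the pull-back of `β` by the projection to `tanX σ A`. -/
noncomputable def extend (h : IsLineGenerator T γ m) {n : ℕ} {A : FrameX σ}
    (β : (tanX σ A) [⋀^Fin n]→ₗ[ℂ] ℂ) : (T A) [⋀^Fin (n + 1)]→ₗ[ℂ] ℂ :=
  linWedge (γ A.1 ∘ₗ (T A).subtype) (β.compLinearMap (h.proj A))

theorem extend_cons (h : IsLineGenerator T γ m) {n : ℕ} {A : FrameX σ}
    (β : (tanX σ A) [⋀^Fin n]→ₗ[ℂ] ℂ) (u : T A) (v : Fin n → tanX σ A) :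
    h.extend β (Fin.cons u fun i => Submodule.inclusion (h.le A) (v i)) = γ A.1 u * β v := by
  refine (linWedge_cons (γ A.1 ∘ₗ (T A).subtype) (β.compLinearMap (h.proj A)) u
    (fun i => Submodule.inclusion (h.le A) (v i)) fun i =>
    (h.mem_tanX_iff A _ (h.le A (v i).2)).1 (v i).2).trans ?_
  simp [proj_inclusion]

/-- The inverse of `contract`: the twisted form `γ ∧ β̃`. -/
noncomputable def wedgeForm (h : IsLineGenerator T γ m) {n : ℕ} {k k' : ℤ} (hk : k = m + k')
    (β : Forms (tanX σ) n k') : Forms T (n + 1) k :=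
  ⟨fun A => h.extend (β.1 A), by
    refine ⟨fun A v i Y hv => ?_, fun g A B hB v w hw => ?_, fun A₀ => ?_⟩
    -- Vertical vectors are tangent to `X`: `γ` vanishes on them and the projection fixes them.
    · have hγ : γ A.1 (v i) = 0 := by
        refine (h.mem_tanX_iff A _ (v i).2).1 ?_
        rw [hv]
        exact vert_mem_tanX A Y
      refine (linWedge_apply _ _ _).trans (Finset.sum_eq_zero fun j _ => ?_)
      obtain rfl | hij := eq_or_ne i j
      · simp [hγ]
      · obtain ⟨i, rfl⟩ := Fin.exists_succAbove_eq hij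
        have : (β.1 A).compLinearMap (h.proj A) (j.removeNth v) = 0 := by
          refine β.2.1 A _ i Y ?_
          rw [coe_proj, Fin.removeNth, hγ, zero_smul, sub_zero, hv]
        simp [this]
    · have hd : (g : Matrix (Fin s) (Fin s) ℂ).det ≠ 0 := g.det.ne_zero
      -- Both sides are determined by their values on a vector of `T A` and tangent vectors of `X`.
      let G : T A →ₗ[ℂ] T B :=
        (act₂ (g : Matrix (Fin s) (Fin s) ℂ)).restrict (h.act_mem g A B hB)
      have h1 : (h.extend (β.1 B)).compLinearMap G =
          (g : Matrix (Fin s) (Fin s) ℂ).det ^ k • h.extend (β.1 A) := by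
        refine h.form_ext fun u v => ?_
        have e : (fun i => G ((Fin.cons u fun i => Submodule.inclusion (h.le A) (v i) :
            Fin (n + 1) → T A) i)) = Fin.cons (G u) fun i => Submodule.inclusion (h.le B)
              ⟨_, act₂_mem_tanX g hB (v i).2⟩ := by
          funext i
          exact Fin.cases rfl (fun i => rfl) i
        rw [AlternatingMap.smul_apply, extend_cons]
        refine (congrArg (h.extend (β.1 B)) e).trans ?_
        rw [extend_cons, β.2.2.1 g A B hB v _ fun i => rfl, hk, zpow_add₀ hd]
        have hG : γ B.1 (G u) = _ := h.apply_act g A B hB u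
        rw [hG, smul_eq_mul]
        ring
      have hwG : w = fun i => G (v i) := funext fun i => Subtype.ext (hw i)
      rw [hwG]
      exact congrArg (fun f => f v) h1
    · obtain ⟨U, hU, hA, α, hα, hr⟩ := β.2.2.2 A₀
      refine ⟨U ∩ {A | LinearIndependent ℂ A}, hU.inter isOpen_setOfPred_linearIndependent,
        ⟨hA, A₀.linearIndependent⟩, fun A => linWedge (γ A) (α A), fun v => ?_,
        fun A hAU v => ?_⟩
      · simp only [linWedge_apply]
        refine Finset.analyticOnNhd_fun_sum _ fun i _ => analyticOnNhd_const.mul ?_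
        exact ((h.analytic _).mono Set.inter_subset_right).mul
          ((hα _).mono Set.inter_subset_left)
      -- The chosen normal vectors do not vary holomorphically, but `γ ∧ β̃` does not depend on the
      -- lift `β̃` of `β`, so `α` may replace it.
      · have h1 : h.extend (β.1 A) = (linWedge (γ A.1) (α A.1)).compLinearMap (T A).subtype := by
          refine h.form_ext fun u v => ?_
          have e : (fun i => (T A).subtype ((Fin.cons u fun i => Submodule.inclusion (h.le A) (v i) :
              Fin (n + 1) → T A) i)) = Fin.cons (u : Tup s l × ℂ) fun i => (v i : Tup s l × ℂ) := by
            funext i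
            exact Fin.cases rfl (fun i => rfl) i
          rw [extend_cons]
          refine Eq.trans ?_ (congrArg (linWedge (γ A.1) (α A.1)) e).symm
          rw [linWedge_cons _ _ _ _ fun i => (h.mem_tanX_iff A _ (h.le A (v i).2)).1 (v i).2,
            hr A hAU.1]
        exact congrArg (fun f => f v) h1⟩

theorem contract_bijective (h : IsLineGenerator T γ m) (hσ : SmoothDivisor σ) (hsl : s ≤ l) {n : ℕ}
    (hn : n + 1 = s * (l + 1 - s)) {k k' : ℤ} (hk : k = m + k') :
    Function.Bijective (h.contract hσ hsl hn hk) := by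
  refine ⟨fun ω η he => ?_, fun β => ⟨h.wedgeForm hk β, ?_⟩⟩
  · refine Subtype.ext (funext fun A => h.form_ext fun u v => ?_)
    rw [h.apply_cons_eq_contract hσ hsl hn hk, h.apply_cons_eq_contract hσ hsl hn hk, he]
  · refine Subtype.ext (funext fun A => AlternatingMap.ext fun v => ?_)
    have h1 := h.extend_cons (β.1 A) (h.normal A) v
    rw [h.apply_normal, one_mul] at h1
    exact h1

/-- The isomorphism `det E ≅ L ⊗ Ωⁿ_X` on global sections, for the dual `E` of `T / vertical`
and the line subbundle `L` generated by `γ`. -/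
noncomputable def detEquiv (h : IsLineGenerator T γ m) (hσ : SmoothDivisor σ) (hsl : s ≤ l) {n : ℕ}
    (hn : n + 1 = s * (l + 1 - s)) {k k' : ℤ} (hk : k = m + k') :
    Forms T (n + 1) k ≃ₗ[ℂ] Forms (tanX σ) n k' :=
  LinearEquiv.ofBijective _ (h.contract_bijective hσ hsl hn hk)

theorem isDetIso_detEquiv (h : IsLineGenerator T γ m) (hσ : SmoothDivisor σ) (hsl : s ≤ l) {n : ℕ}
    (hn : n + 1 = s * (l + 1 - s)) {k k' : ℤ} (hk : k = m + k') :
    IsDetIso h.le (fun A w => γ A.1 w) (h.detEquiv hσ hsl hn hk) :=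
  fun ω A u v => h.apply_cons_eq_contract hσ hsl hn hk ω A u v

end IsLineGenerator

end Determinant

/-! ### The generators `dσ` and `-dt` -/

section Generators
variable {s l : ℕ} {a : ℤ}

/-- Near a frame of a point of the smooth divisor there is a holomorphic field of tangent vectors
on which `dσ` is `1`. -/
theorem exists_fderiv_eq_one {σ : Sec s l a} (hσ : SmoothDivisor σ) (A₀ : FrameX σ) :
    ∃ U : Set (Tup s l), IsOpen U ∧ A₀.1 ∈ U ∧ U ⊆ {A | LinearIndependent ℂ A} ∧
      ∃ H : Tup s l → Tup s l, AnalyticOnNhd ℂ H U ∧ ∀ A ∈ U, fderiv ℂ σ.1 A (H A) = 1 := by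
  obtain ⟨H, hH⟩ : ∃ H, fderiv ℂ σ.1 A₀.1 H ≠ 0 := by
    by_contra! h
    exact hσ A₀ (ContinuousLinearMap.ext h)
  have han := analyticOnNhd_fderiv_sec σ H
  have ho : IsOpen {A : Tup s l | LinearIndependent ℂ A} := isOpen_setOfPred_linearIndependent
  refine ⟨{A | LinearIndependent ℂ A} ∩ (fun A => fderiv ℂ σ.1 A H) ⁻¹' {0}ᶜ,
    han.continuousOn.isOpen_inter_preimage ho isOpen_compl_singleton,
    ⟨A₀.linearIndependent, hH⟩, Set.inter_subset_left,
    fun A => (fderiv ℂ σ.1 A H)⁻¹ • H, ?_, fun A hA => ?_⟩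
  · exact fun A hA => ((han A hA.1).inv hA.2).smul analyticAt_const
  · rw [map_smul, smul_eq_mul, inv_mul_cancel₀ hA.2]

/-- The conormal sequence: `dσ` generates the kernel of `Ω¹_𝔾|X → Ω¹_X`. -/
theorem isLineGenerator_dσ {σ : Sec s l a} (hσ : SmoothDivisor σ) :
    IsLineGenerator (tanG σ)
      (fun A => (fderiv ℂ σ.1 A).toLinearMap ∘ₗ LinearMap.fst ℂ (Tup s l) ℂ) a where
  le := tanX_le_tanG σ
  mem_tanX_iff A v hv := by
    rw [mem_tanX]
    exact and_iff_left hv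
  act_mem g A B hB v hv := hv
  apply_act g A B hB v := fderiv_act σ g A.linearIndependent B.linearIndependent hB v.1
  analytic v := analyticOnNhd_fderiv_sec σ v.1
  exists_section A₀ := by
    obtain ⟨U, hU, hA, -, H, hH, h1⟩ := exists_fderiv_eq_one hσ A₀
    exact ⟨U, hU, hA, fun A => (H A, 0), fun A hA => (hH A hA).prod analyticAt_const,
      fun A hA => ⟨rfl, h1 _ hA⟩⟩

/-- The sequence of the deformation: `-dt` generates the kernel of `Ω¹_𝒳|X → Ω¹_X`. -/
theorem isLineGenerator_neg_dt {σ : Sec s l a} (R : Sec s l a) (hσ : SmoothDivisor σ) :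
    IsLineGenerator (tanDef σ R) (fun _ => -LinearMap.snd ℂ (Tup s l) ℂ) 0 where
  le := tanX_le_tanDef σ R
  mem_tanX_iff A v hv := by
    rw [mem_tanDef] at hv
    rw [mem_tanX]
    refine ⟨fun h => by simp [h.2], fun h => ?_⟩
    have h2 : v.2 = 0 := by simpa using h
    exact ⟨by simpa [h2] using hv, h2⟩
  act_mem g A B hB v hv := by
    have h1 := fderiv_act σ g A.linearIndependent B.linearIndependent hB v.1
    have h2 := R.2.2.2 g A.1 A.linearIndependent
    rw [mem_tanDef] at hv ⊢
    rw [← hB] at h2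
    change fderiv ℂ σ.1 B.1 (act (g : Matrix (Fin s) (Fin s) ℂ) v.1) + v.2 * R.1 B.1 = 0
    rw [h1, h2]
    linear_combination (g : Matrix (Fin s) (Fin s) ℂ).det ^ a * hv
  apply_act g A B hB v := by simp [act₂]
  analytic v := analyticOnNhd_const
  exists_section A₀ := by
    obtain ⟨U, hU, hA, hUi, H, hH, h1⟩ := exists_fderiv_eq_one hσ A₀
    -- With `dt = -1`, tangency to `𝒳` requires `dσ = R`.
    refine ⟨U, hU, hA, fun A => (R.1 A • H A, -1), fun A hA => ?_, fun A hA => ⟨?_, by simp⟩⟩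
    · exact ((R.2.2.1 A (hUi hA)).smul (hH A hA)).prod analyticAt_const
    · rw [mem_tanDef, map_smul, h1 _ hA]
      simp

/-! ### The map `φ` on top forms -/

/-- On `T𝒳` one has `dσ = -R dt`, whence `φ(dσ ∧ β̃) = -R dt ∧ β̃`: the identifications of the
determinants turn the top exterior power of `φ` into multiplication by `R`. -/
theorem isDetIso_phi {σ R : Sec s l a} (hσ : SmoothDivisor σ) {n : ℕ} {k k₁ k₂ : ℤ}
    {eG : Forms (tanG σ) (n + 1) k ≃ₗ[ℂ] Forms (tanX σ) n k₁}
    {eX : Forms (tanDef σ R) (n + 1) k ≃ₗ[ℂ] Forms (tanX σ) n k₂}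
    (hG : IsDetIso (tanX_le_tanG σ) (fun A w => fderiv ℂ σ.1 A.1 w.1) eG)
    (hX : IsDetIso (tanX_le_tanDef σ R) (fun _ w => -w.2) eX) (hk : k₂ = a + k₁)
    (ω : Forms (tanG σ) (n + 1) k) : eX (phi σ R (n + 1) k ω) = mulSec R n hk (eG ω) := by
  refine Subtype.ext (funext fun A => AlternatingMap.ext fun v => ?_)
  obtain ⟨u, hu⟩ := (isLineGenerator_neg_dt R hσ).exists_apply_eq_one A
  have hu1 : -(u : Tup s l × ℂ).2 = 1 := hu
  have hu2 := mem_tanDef.1 u.2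
  have h1 := hX (phi σ R (n + 1) k ω) A u v
  let u' : tanG σ A := ⟨((u : Tup s l × ℂ).1, 0), rfl⟩
  have h2 := hG ω A u' v
  have e : (phi σ R (n + 1) k ω).1 A
      (Fin.cons u fun i => Submodule.inclusion (tanX_le_tanDef σ R A) (v i)) =
        ω.1 A (Fin.cons u' fun i => Submodule.inclusion (tanX_le_tanG σ A) (v i)) := by
    refine congrArg (ω.1 A) (funext fun i => ?_)
    refine Fin.cases rfl (fun i => Subtype.ext (Prod.ext rfl ?_)) i
    exact (mem_tanX.1 (v i).2).2.symm
  have h3 : (mulSec R n hk (eG ω)).1 A v = R.1 A.1 * (eG ω).1 A v := rfl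
  have hR : fderiv ℂ σ.1 A.1 (u : Tup s l × ℂ).1 = R.1 A.1 := by
    linear_combination hu2 + R.1 A.1 * hu1
  rw [h3, ← hR, ← one_mul ((eX _).1 A v), ← hu1]
  exact h1.symm.trans (e.trans h2)

theorem restr_phi (σ R : Sec s l a) (p : ℕ) (k : ℤ) (ω : Forms (tanG σ) p k) :
    restr (tanX_le_tanDef σ R) p k (phi σ R p k ω) = restr (tanX_le_tanG σ) p k ω := by
  refine Subtype.ext (funext fun A => AlternatingMap.ext fun v => congrArg (ω.1 A) ?_)
  exact funext fun i => Subtype.ext (Prod.ext rfl (mem_tanX.1 (v i).2).2.symm)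

theorem wedge_phi (σ R : Sec s l a) {N : ℕ} {k : ℤ} (ω : Fin N → Forms (tanG σ) 1 k) :
    (wedge fun i => phi σ R 1 k (ω i)) = phi σ R N (N * k) (wedge ω) := rfl

end Generators
end GrassAdjoint

theorem mainTheorem9 (l s n a : ℕ) (hl : 3 ≤ l) (hs : 1 ≤ s) (hsl : s ≤ l) (ha : l < a)
    (hn : n + 1 = s * (l + 1 - s)) (σ R : Sec s l (a : ℤ)) (hσ : SmoothDivisor σ) :
    ∃ (eG : Forms (tanG σ) (n + 1) (((n + 1 : ℕ) : ℤ) * 2) ≃ₗ[ℂ]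
          Forms (tanX σ) n (((n + 1 : ℕ) : ℤ) * 2 - a))
      (eX : Forms (tanDef σ R) (n + 1) (((n + 1 : ℕ) : ℤ) * 2) ≃ₗ[ℂ]
          Forms (tanX σ) n (((n + 1 : ℕ) : ℤ) * 2)),
      IsDetIso (tanX_le_tanG σ) (fun A w => fderiv ℂ σ.1 A.1 w.1) eG ∧
      IsDetIso (tanX_le_tanDef σ R) (fun _ w => -w.2) eX ∧
      (∀ β : Forms (tanX σ) n (((n + 1 : ℕ) : ℤ) * 2 - a),
        eX (phi σ R (n + 1) _ (eG.symm β)) = mulSec R n (by ring) β) ∧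
      (∀ ω : Forms (tanG σ) 1 2,
        restr (tanX_le_tanDef σ R) 1 2 (phi σ R 1 2 ω) = restr (tanX_le_tanG σ) 1 2 ω) ∧
      ∀ (η : Fin (n + 1) → Forms (tanX σ) 1 2) (lift : Fin (n + 1) → Forms (tanG σ) 1 2),
        (∀ i, restr (tanX_le_tanG σ) 1 2 (lift i) = η i) →
        (∀ i, restr (tanX_le_tanDef σ R) 1 2 (phi σ R 1 2 (lift i)) = η i) ∧
        eX (wedge fun i => phi σ R 1 2 (lift i)) =
          mulSec R n (by ring) (eG (wedge lift)) := by
  have hG := (isLineGenerator_dσ hσ).isDetIso_detEquiv hσ hsl hn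
    (k := ((n + 1 : ℕ) : ℤ) * 2) (k' := ((n + 1 : ℕ) : ℤ) * 2 - a) (by ring)
  have hX := (isLineGenerator_neg_dt R hσ).isDetIso_detEquiv hσ hsl hn
    (k := ((n + 1 : ℕ) : ℤ) * 2) (k' := ((n + 1 : ℕ) : ℤ) * 2) (by ring)
  refine ⟨_, _, hG, hX, fun β => ?_, restr_phi σ R 1 2, fun η lift hη => ⟨fun i => ?_, ?_⟩⟩
  · rw [isDetIso_phi hσ hG hX (by ring), LinearEquiv.apply_symm_apply]
  · rw [restr_phi, hη]
  · rw [wedge_phi]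
    exact isDetIso_phi hσ hG hX (by ring) _
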